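/- **Setting.** An offline $A$-armed bandit consists of mean rewards $r:\{1,\dots,A\}\to[0,1]$, a behavior policy $\pi^{\mathsf{ref}}$ (a probability vector on the arms), and a $1$-sub-Gaussian noise law, i.e. $\mathbb{E}[e^{t\varepsilon}]\le e^{t^2/2}$ for all $t\in\mathbb{R}$. A dataset $\mathcal{D}=\{(a_i,r_i)\}_{i=1}^n$ consists of $n$ i.i.d. samples with $a_i\sim\pi^{\mathsf{ref}}$ and $r_i=r(a_i)+\varepsilon_i$, where $\varepsilon_i$ follows the noise law and is independent of $a_i$. An algorithm maps the dataset, possibly with internal randomization, to a policy $\hat\pi$, i.e. a probability vector on the arms. Put $J(\pi)=\sum_a \pi(a)r(a)$ and $\mathrm{SubOpt}(\pi)=\max_{\pi'}J(\pi')-J(\pi)$. An arm $a$ is suboptimal if $r(a)<\max_{b}r(b)$. **Theorem.** There is an absolute constant $c>0$ such that for all integers $A>K>0$ there is an $n_0=n_0(A,K)$ such that for every $n\ge n_0$ and every algorithm there exists an offline $A$-armed bandit with uniform behavior policy, $\pi^{\mathsf{ref}}(a)=1/A$ for every $a$, and with exactly $K$ suboptimal arms, on which the output $\hat\pi$ of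 the algorithm from $n$ samples satisfies $$\mathbb{E}\big[\mathrm{SubOpt}(\hat\pi)\big]\;\ge\; c\,\frac{K}{\sqrt{n\,A\log A}},$$ where the expectation is over the dataset and the internal randomness of the algorithm. -/

import Mathlib

open MeasureTheory ProbabilityTheory

noncomputable section

namespace OfflineMAB

/-- A policy: a probability vector over the `A` arms. -/
abbrev Policy (A : ℕ) : Type := stdSimplex ℝ (Fin A)

/-- A dataset of `n` action-reward pairs. -/
abbrev Dataset (A n : ℕ) : Type := Fin n → Fin A × ℝ

/-- The law on the arms of an action drawn from the policy `p`. -/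
def Policy.law {A : ℕ} (p : Policy A) : Measure (Fin A) :=
  ∑ a, ENNReal.ofReal (p.1 a) • Measure.dirac a

/-- An offline multi-armed bandit with `A` arms: mean rewards in `[0, 1]`, a behavior policy, and
a `1`-sub-Gaussian noise law, i.e. `𝔼[exp (t ε)] ≤ exp (t ^ 2 / 2)` for all real `t`
(which forces the noise to be centered). -/
structure Bandit (A : ℕ) where
  reward : Fin A → ℝ
  reward_mem : ∀ a, reward a ∈ Set.Icc (0 : ℝ) 1
  behavior : Policy A
  noise : Measure ℝ
  noise_prob : IsProbabilityMeasure noise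
  noise_subGaussian : HasSubgaussianMGF id 1 noise

namespace Bandit

variable {A : ℕ} (M : Bandit A)

/-- The law of one sample `(a, r a + ε)`, where `a` is drawn from the behavior policy and `ε`
is a noise variable independent of `a`. -/
def sampleLaw : Measure (Fin A × ℝ) :=
  (M.behavior.law.prod M.noise).map (fun x => (x.1, M.reward x.1 + x.2))

/-- The law of a dataset of `n` independent samples. -/
def dataLaw (n : ℕ) : Measure (Dataset A n) :=
  Measure.pi (fun _ => M.sampleLaw)

/-- The unregularized objective `J(π) = 𝔼_{a ∼ π}[r(a)]`. -/
def value (p : Policy A) : ℝ := ∑ a, p.1 a * M.reward a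

/-- The optimal value `J(π*) = max_π J(π)` (the maximum is attained, see `exists_optimal`). -/
def optValue : ℝ := ⨆ p : Policy A, M.value p

/-- The suboptimality gap `J(π*) - J(π)`. -/
def subOpt (p : Policy A) : ℝ := M.optValue - M.value p

open Classical in
/-- The arms with maximal mean reward. -/
def optimalArms : Finset (Fin A) :=
  Finset.univ.filter (fun a => ∀ b, M.reward b ≤ M.reward a)

/-- The arms whose mean reward is not maximal. -/
def suboptimalArms : Finset (Fin A) := M.optimalArmsᶜ

/-- The behavior policy is uniform over the arms. -/
def HasUniformBehavior : Prop := ∀ a, M.behavior.1 a = 1 / (A : ℝ)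

/-- The expected suboptimality of a (possibly randomized) algorithm, over the draw of the
`n`-sample dataset and the internal randomness of the algorithm. -/
def expectedSubOpt {n : ℕ} (alg : Kernel (Dataset A n) (Policy A)) : ℝ :=
  ∫ p, M.subOpt p ∂((M.dataLaw n).bind alg)

end Bandit

instance Policy.isProbabilityMeasure_law {A : ℕ} (p : Policy A) :
    IsProbabilityMeasure p.law := by
  constructor
  simp only [Policy.law, Measure.coe_finsetSum, Finset.sum_apply, Measure.smul_apply,
    measure_univ, smul_eq_mul, mul_one]
  rw [← ENNReal.ofReal_sum_of_nonneg (fun a _ => p.2.1 a), p.2.2, ENNReal.ofReal_one]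

instance Bandit.isProbabilityMeasure_sampleLaw {A : ℕ} (M : Bandit A) :
    IsProbabilityMeasure M.sampleLaw := by
  have := M.noise_prob
  refine Measure.isProbabilityMeasure_map (Measurable.aemeasurable ?_)
  exact measurable_fst.prodMk
    (((measurable_of_finite M.reward).comp measurable_fst).add measurable_snd)

instance Bandit.isProbabilityMeasure_dataLaw {A : ℕ} (M : Bandit A) (n : ℕ) :
    IsProbabilityMeasure (M.dataLaw n) := by
  unfold Bandit.dataLaw
  infer_instance

/-- An optimal policy exists, and its value is `optValue`. -/
theorem Bandit.exists_optimal {A : ℕ} (M : Bandit A) :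
    ∃ p : Policy A, (∀ q, M.value q ≤ M.value p) ∧ M.optValue = M.value p := by
  have : Nonempty (Policy A) := ⟨M.behavior⟩
  have : CompactSpace (Policy A) := isCompact_iff_compactSpace.mp (isCompact_stdSimplex ℝ (Fin A))
  have hc : Continuous M.value := by
    exact continuous_finsetSum _ fun a _ =>
      ((continuous_apply a).comp continuous_subtype_val).mul continuous_const
  obtain ⟨p, -, hp⟩ := isCompact_univ.exists_isMaxOn Set.univ_nonempty hc.continuousOn
  have h : ∀ q, M.value q ≤ M.value p := fun q => hp (Set.mem_univ q)
  exact ⟨p, h, le_antisymm (ciSup_le h) (le_ciSup ⟨M.value p, by rintro _ ⟨q, rfl⟩; exact h q⟩ p)⟩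

end OfflineMAB

end

/-!
The hard instances are the bandits `gapBandit δ S` with standard Gaussian noise, in which the arms
of a set `S` of cardinality `K` have mean reward `1 - δ` and all other arms have mean reward `1`,
where `δ = A / √(n * A * log A)`. On such a bandit the suboptimality of a policy is `δ` times the
mass that it puts on `S`, so it is enough to find an `S` on which the algorithm puts, in
expectation, a mass of order `K / A`.

The gap is so small that an algorithm cannot even tell one bad arm apart from the good ones. Each
arm is sampled about `n / A` times, so the likelihood ratio between the bandits with suboptimal
sets `insert a S` and `S` is about `exp (-z * δ * √(n / A))` with `z` standard normal, and
`δ * √(n / A) = 1 / √(log A)`. As the maximum of `A` standard normals has order `√(log A)`, the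
`A` likelihood ratios are bounded below by a constant simultaneously. To avoid conditioning on the
numbers of samples, this is expressed through the moment of order `-log A` of the
likelihood ratio, which factors over the samples and is bounded by `exp (log A + 1)`
(`lintegral_expLogRatio`, `error_term_le`). The result is `sum_expectedArmProb_insert_ge`: passing
from `S` to `insert a S` decreases the expected mass of any set of arms by at most a constant
factor, up to an error that is summable over the arms.

The conclusion is an averaging argument (`exists_card_eq_le_sum`) over the sets `T` with `K - 1`
elements. If for some `T` the algorithm puts constant mass on `T` under the bandit of `T`, it does
so under the bandit of `insert a T` as well, and `insert a T` is the required set. Otherwise, for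
every `T`, it puts constant mass on the complement of `T`, and the masses of `a` under the bandits
of `insert a T` add up to at least a constant over `a ∉ T`. By double counting, the average over
all `S` of the mass on `S` is then at least of order `K / (A - K + 1)`.
-/

open scoped ENNReal

/-! ### Products of a measure with itself -/

namespace MeasureTheory

theorem lintegral_pi_prod {α : Type*} [MeasurableSpace α] (μ : Measure α) [SigmaFinite μ] :
    ∀ {n : ℕ} {f : Fin n → α → ℝ≥0∞}, (∀ i, Measurable (f i)) →
      ∫⁻ x, ∏ i, f i (x i) ∂Measure.pi (fun _ : Fin n => μ) = ∏ i, ∫⁻ x, f i x ∂μ := by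
  intro n
  induction n with
  | zero => intro f _; simp
  | succ n ih =>
    intro f hf
    have hmp := (measurePreserving_piFinSuccAbove (fun _ : Fin (n + 1) => μ) 0).symm
    rw [← hmp.lintegral_comp (by fun_prop)]
    simp only [Fin.prod_univ_succ, MeasurableEquiv.piFinSuccAbove_symm_apply,
      Fin.insertNthEquiv, Fin.insertNth_zero, Equiv.coe_fn_mk, Fin.cons_zero, Fin.cons_succ]
    rw [← ih (f := fun i => f i.succ) fun i => hf i.succ]
    have hm : Measurable fun x : Fin n → α => ∏ i, f i.succ (x i) :=
      Finset.measurable_prod _ fun i _ => (hf i.succ).comp (measurable_pi_apply i)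
    exact lintegral_prod_mul (hf 0).aemeasurable hm.aemeasurable

theorem Measure.pi_withDensity {α : Type*} [MeasurableSpace α] (μ : Measure α) [SigmaFinite μ]
    (n : ℕ) {f : α → ℝ≥0∞} (hf : Measurable f) [SigmaFinite (μ.withDensity f)] :
    Measure.pi (fun _ : Fin n => μ.withDensity f) =
      (Measure.pi (fun _ : Fin n => μ)).withDensity (fun x => ∏ i, f (x i)) := by
  refine Measure.pi_eq fun s hs => ?_
  rw [withDensity_apply _ (MeasurableSet.univ_pi hs),
    ← lintegral_indicator (MeasurableSet.univ_pi hs)]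
  simp only [withDensity_apply _ (hs _), ← lintegral_indicator (hs _)]
  rw [← lintegral_pi_prod μ fun i => hf.indicator (hs i)]
  refine lintegral_congr fun x => ?_
  by_cases hx : x ∈ Set.univ.pi s
  · rw [Set.indicator_of_mem hx]
    exact Finset.prod_congr rfl fun i _ => (Set.indicator_of_mem (hx i (Set.mem_univ i)) _).symm
  · rw [Set.indicator_of_notMem hx]
    obtain ⟨i, hi⟩ : ∃ i, x i ∉ s i := by simpa using hx
    exact (Finset.prod_eq_zero (Finset.mem_univ i) (Set.indicator_of_notMem hi _)).symm

end MeasureTheory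

/-! ### Gaussian integrals -/

namespace ProbabilityTheory

theorem lintegral_exp_gaussianReal (t u : ℝ) :
    ∫⁻ x, ENNReal.ofReal (Real.exp (t * x + u)) ∂gaussianReal 0 1 =
      ENNReal.ofReal (Real.exp (t ^ 2 / 2 + u)) := by
  have hi : Integrable (fun x => Real.exp (t * x) * Real.exp u) (gaussianReal 0 1) :=
    (integrable_exp_mul_gaussianReal t).mul_const _
  simp only [Real.exp_add]
  rw [← ofReal_integral_eq_lintegral_ofReal hi (ae_of_all _ fun x => by positivity),
    integral_mul_const]
  have h := congrFun (mgf_id_gaussianReal (μ := 0) (v := 1)) t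
  simp only [mgf, id] at h
  rw [h]
  simp

/-- A translate of the standard Gaussian measure has an exponential density with respect to it. -/
theorem lintegral_sub_gaussianReal (δ : ℝ) {h : ℝ → ℝ≥0∞} (hh : Measurable h) :
    ∫⁻ x, h (x - δ) ∂gaussianReal 0 1 =
      ∫⁻ x, ENNReal.ofReal (Real.exp (-(δ * x + δ ^ 2 / 2))) * h x ∂gaussianReal 0 1 := by
  rw [← lintegral_map hh (by fun_prop : Measurable fun x : ℝ => x - δ), gaussianReal_map_sub_const,
    gaussianReal_of_var_ne_zero _ one_ne_zero, gaussianReal_of_var_ne_zero _ one_ne_zero,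
    lintegral_withDensity_eq_lintegral_mul _ (measurable_gaussianPDF _ _) hh,
    lintegral_withDensity_eq_lintegral_mul _ (measurable_gaussianPDF _ _) (by fun_prop)]
  refine lintegral_congr fun x => ?_
  simp only [Pi.mul_apply, ← mul_assoc, gaussianPDF]
  rw [← ENNReal.ofReal_mul (gaussianPDFReal_nonneg _ _ _)]
  congr 2
  simp only [gaussianPDFReal, mul_assoc, ← Real.exp_add]
  congr 2
  norm_num
  ring

end ProbabilityTheory

/-! ### Bandits with a gap on a set of arms -/

namespace OfflineMAB

/-- The policy that gives all arms the same probability. -/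
noncomputable def Policy.uniform (A : ℕ) [NeZero A] : Policy A :=
  ⟨fun _ => 1 / (A : ℝ), fun _ => by positivity, by simp [NeZero.ne A]⟩

/-- The bandit with uniform behavior policy and standard Gaussian noise in which the arms of `S`
have mean reward `1 - δ` and all other arms have mean reward `1`. -/
noncomputable def gapBandit {A : ℕ} [NeZero A] (δ : Set.Icc (0 : ℝ) 1) (S : Finset (Fin A)) :
    Bandit A where
  reward a := if a ∈ S then 1 - δ else 1
  reward_mem a := by
    obtain ⟨δ, h0, h1⟩ := δ
    dsimp only
    split_ifs <;> constructor <;> linarith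
  behavior := Policy.uniform A
  noise := gaussianReal 0 1
  noise_prob := inferInstance
  noise_subGaussian :=
    ⟨fun t => integrable_exp_mul_gaussianReal t, fun t => by simp [mgf_id_gaussianReal]⟩

/-! ### Likelihood ratios -/

/-- The power `-t` of the likelihood ratio, at one sample, of the bandit in which arm `a` is
suboptimal to the one in which it is optimal: `exp (t * (δ * (r - 1) + δ ^ 2 / 2))` at a sample of
arm `a` with reward `r`, and `1` at samples of other arms. -/
noncomputable def expLogRatio {A : ℕ} (δ : ℝ) (a : Fin A) (t : ℝ) (x : Fin A × ℝ) : ℝ≥0∞ :=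
  if x.1 = a then ENNReal.ofReal (Real.exp (t * (δ * (x.2 - 1) + δ ^ 2 / 2))) else 1

theorem measurable_expLogRatio {A : ℕ} (δ : ℝ) (a : Fin A) (t : ℝ) :
    Measurable (expLogRatio δ a t) :=
  Measurable.ite (measurable_fst (measurableSet_singleton a)) (by fun_prop) measurable_const

theorem prod_expLogRatio {A n : ℕ} (δ : ℝ) (a : Fin A) (t : ℝ) (d : Dataset A n) :
    ∏ i, expLogRatio δ a t (d i) = ENNReal.ofReal (Real.exp
      (t * ∑ i, if (d i).1 = a then δ * ((d i).2 - 1) + δ ^ 2 / 2 else 0)) := by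
  rw [Finset.mul_sum, Real.exp_sum, ENNReal.ofReal_prod_of_nonneg fun i _ => by positivity]
  refine Finset.prod_congr rfl fun i _ => ?_
  unfold expLogRatio
  split_ifs <;> simp

/-- A likelihood ratio `exp (-y)` is at least `exp (-s)`, up to an error that is exponentially
small in the excess of `y` over `s`. -/
theorem exp_neg_le_exp_neg_add {s t : ℝ} (ht : 0 ≤ t) (y : ℝ) :
    Real.exp (-s) ≤ Real.exp (-y) + Real.exp (-s) * Real.exp (-(t * s)) * Real.exp (t * y) := by
  rcases le_total y s with h | h
  · have := Real.exp_le_exp.mpr (neg_le_neg h)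
    have : 0 ≤ Real.exp (-s) * Real.exp (-(t * s)) * Real.exp (t * y) := by positivity
    linarith
  · have h1 : 1 ≤ Real.exp (-(t * s)) * Real.exp (t * y) := by
      rw [← Real.exp_add]
      exact Real.one_le_exp (by nlinarith)
    have := le_mul_of_one_le_right (Real.exp_pos (-s)).le h1
    have := Real.exp_pos (-y)
    rw [mul_assoc]
    linarith

section

variable {A : ℕ} [NeZero A] (δ : Set.Icc (0 : ℝ) 1) (S : Finset (Fin A))

theorem lintegral_sampleLaw_gapBandit {f : Fin A × ℝ → ℝ≥0∞} (hf : Measurable f) :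
    ∫⁻ x, f x ∂(gapBandit δ S).sampleLaw =
      ENNReal.ofReal (1 / A) *
        ∑ a, ∫⁻ x, f (a, (gapBandit δ S).reward a + x) ∂gaussianReal 0 1 := by
  have hm : Measurable fun x : Fin A × ℝ => (x.1, (gapBandit δ S).reward x.1 + x.2) :=
    measurable_fst.prodMk
      (((measurable_of_finite (gapBandit δ S).reward).comp measurable_fst).add measurable_snd)
  rw [Bandit.sampleLaw, lintegral_map hf hm]
  change ∫⁻ x, _ ∂((Policy.uniform A).law.prod (gaussianReal 0 1)) = _
  rw [lintegral_prod (fun x => f (x.1, _)) (hf.comp hm).aemeasurable]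
  simp [Policy.law, Policy.uniform, Finset.mul_sum]

theorem optimalArms_gapBandit (hδ : 0 < (δ : ℝ)) (hS : S ≠ Finset.univ) :
    (gapBandit δ S).optimalArms = Sᶜ := by
  obtain ⟨b, hb⟩ : ∃ b, b ∉ S := by simpa [Finset.eq_univ_iff_forall] using hS
  ext a
  rw [Bandit.optimalArms, Finset.mem_filter, Finset.mem_compl]
  simp only [gapBandit, Finset.mem_univ, true_and]
  constructor
  · intro h ha
    have := h b
    rw [if_neg hb, if_pos ha] at this
    linarith
  · intro ha c
    rw [if_neg ha]
    split_ifs <;> linarith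

theorem value_gapBandit (p : Policy A) :
    (gapBandit δ S).value p = 1 - δ * ∑ a ∈ S, p.1 a := by
  have h : ∀ a, p.1 a * (gapBandit δ S).reward a =
      p.1 a - δ * if a ∈ S then p.1 a else 0 := by
    intro a
    simp only [gapBandit]
    split_ifs <;> ring
  have h1 : ∑ a, p.1 a = 1 := p.2.2
  rw [Bandit.value, Finset.sum_congr rfl fun a _ => h a, Finset.sum_sub_distrib, h1,
    ← Finset.mul_sum]
  simp

theorem subOpt_gapBandit (hS : S ≠ Finset.univ) (p : Policy A) :
    (gapBandit δ S).subOpt p = δ * ∑ a ∈ S, p.1 a := by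
  obtain ⟨b, hb⟩ : ∃ b, b ∉ S := by simpa [Finset.eq_univ_iff_forall] using hS
  obtain ⟨q, hq, hopt⟩ := (gapBandit δ S).exists_optimal
  have h1 := hq ⟨Pi.single b 1, single_mem_stdSimplex ℝ b⟩
  have h2 : (0 : ℝ) ≤ δ * ∑ a ∈ S, q.1 a :=
    mul_nonneg δ.2.1 (Finset.sum_nonneg fun a _ => q.2.1 a)
  have h3 : ∑ a ∈ S, (Pi.single b 1 : Fin A → ℝ) a = 0 :=
    Finset.sum_eq_zero fun a ha => Pi.single_eq_of_ne (ne_of_mem_of_not_mem ha hb) 1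
  rw [value_gapBandit, value_gapBandit, h3] at h1
  rw [Bandit.subOpt, hopt, value_gapBandit, value_gapBandit]
  linarith

/-- Only the event that arm `a` is sampled, of probability `1 / A`, makes the expectation differ
from `1`; as `a` is optimal, its reward is there a Gaussian with mean `1`. -/
theorem lintegral_expLogRatio {a : Fin A} (ha : a ∉ S) (t : ℝ) :
    ∫⁻ x, expLogRatio δ a t x ∂(gapBandit δ S).sampleLaw =
      ENNReal.ofReal (1 + (Real.exp ((t ^ 2 + t) * δ ^ 2 / 2) - 1) / A) := by
  have hA : (0 : ℝ) < A := by exact_mod_cast NeZero.pos A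
  have h : ∀ b, ∫⁻ x, expLogRatio δ a t (b, (gapBandit δ S).reward b + x) ∂gaussianReal 0 1 =
      ENNReal.ofReal (1 + if b = a then Real.exp ((t ^ 2 + t) * δ ^ 2 / 2) - 1 else 0) := by
    intro b
    by_cases hb : b = a
    · subst hb
      have h1 := lintegral_exp_gaussianReal (t * δ) (t * (δ ^ 2 / 2))
      simp only [expLogRatio, gapBandit, if_neg ha, if_true, add_sub_cancel_left, add_sub_cancel]
      convert h1 using 4 <;> ring_nf
    · simp [expLogRatio, hb]
  have h0 : ∀ b, (0 : ℝ) ≤ 1 + if b = a then Real.exp ((t ^ 2 + t) * δ ^ 2 / 2) - 1 else 0 := by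
    intro b
    split_ifs
    · rw [add_sub_cancel]; positivity
    · norm_num
  rw [lintegral_sampleLaw_gapBandit δ S (measurable_expLogRatio δ a t)]
  simp only [h]
  rw [← ENNReal.ofReal_sum_of_nonneg fun b _ => h0 b, ← ENNReal.ofReal_mul (by positivity)]
  congr 1
  simp [Finset.sum_add_distrib]
  field_simp

theorem sampleLaw_gapBandit_insert {a : Fin A} (ha : a ∉ S) :
    (gapBandit δ (insert a S)).sampleLaw =
      (gapBandit δ S).sampleLaw.withDensity (expLogRatio δ a (-1)) := by
  have hm := measurable_expLogRatio δ a (-1)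
  ext s hs
  have hi : Measurable (s.indicator (1 : Fin A × ℝ → ℝ≥0∞)) := measurable_one.indicator hs
  rw [← lintegral_indicator_one hs, ← lintegral_indicator_one hs,
    lintegral_withDensity_eq_lintegral_mul _ hm hi, lintegral_sampleLaw_gapBandit _ _ hi,
    lintegral_sampleLaw_gapBandit _ _ (hm.mul hi)]
  congr 1
  refine Finset.sum_congr rfl fun b _ => ?_
  by_cases hb : b = a
  · subst hb
    have h1 := lintegral_sub_gaussianReal δ
      (h := fun x => s.indicator (1 : Fin A × ℝ → ℝ≥0∞) (b, 1 + x))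
      (hi.comp (by fun_prop))
    simp only [gapBandit, Finset.mem_insert_self, if_true, if_neg ha, Pi.mul_apply, expLogRatio,
      add_sub_cancel_left, neg_one_mul]
    rw [← h1]
    refine lintegral_congr fun x => ?_
    congr 2
    ring
  · simp [expLogRatio, gapBandit, hb]

theorem dataLaw_gapBandit_insert (n : ℕ) {a : Fin A} (ha : a ∉ S) :
    (gapBandit δ (insert a S)).dataLaw n =
      ((gapBandit δ S).dataLaw n).withDensity fun d => ∏ i, expLogRatio δ a (-1) (d i) := by
  have hP : IsProbabilityMeasure
      ((gapBandit δ S).sampleLaw.withDensity (expLogRatio δ a (-1))) := by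
    rw [← sampleLaw_gapBandit_insert δ S ha]
    infer_instance
  simp only [Bandit.dataLaw]
  rw [sampleLaw_gapBandit_insert δ S ha,
    Measure.pi_withDensity _ n (measurable_expLogRatio δ a (-1))]

/-- Change of measure: making one more arm suboptimal decreases the expectation of a
`[0, 1]`-valued statistic by at most the factor `exp (-s)`, up to an additive error. -/
theorem lintegral_le_lintegral_insert {n : ℕ} {a : Fin A} (ha : a ∉ S) {s t : ℝ} (ht : 0 ≤ t)
    {f : Dataset A n → ℝ≥0∞} (hf : Measurable f) (hf1 : ∀ d, f d ≤ 1) :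
    ENNReal.ofReal (Real.exp (-s)) * ∫⁻ d, f d ∂(gapBandit δ S).dataLaw n ≤
      ∫⁻ d, f d ∂(gapBandit δ (insert a S)).dataLaw n +
        ENNReal.ofReal (Real.exp (-s) * Real.exp (-(t * s))) *
          ENNReal.ofReal (1 + (Real.exp ((t ^ 2 + t) * δ ^ 2 / 2) - 1) / A) ^ n := by
  have hm : ∀ u, Measurable fun d : Dataset A n => ∏ i, expLogRatio δ a u (d i) := fun u =>
    Finset.measurable_prod _ fun i _ =>
      (measurable_expLogRatio δ a u).comp (measurable_pi_apply i)
  have hmom : ∫⁻ d, ∏ i, expLogRatio δ a t (d i) ∂(gapBandit δ S).dataLaw n =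
      ENNReal.ofReal (1 + (Real.exp ((t ^ 2 + t) * δ ^ 2 / 2) - 1) / A) ^ n := by
    rw [Bandit.dataLaw, lintegral_pi_prod _ fun _ => measurable_expLogRatio δ a t]
    simp [lintegral_expLogRatio δ S ha]
  rw [dataLaw_gapBandit_insert δ S n ha, lintegral_withDensity_eq_lintegral_mul _ (hm _) hf,
    ← hmom, ← lintegral_const_mul _ hf, ← lintegral_const_mul _ (hm t),
    ← lintegral_add_left ((hm _).mul hf)]
  refine lintegral_mono fun d => ?_
  simp only [Pi.mul_apply, prod_expLogRatio, neg_one_mul]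
  set y : ℝ := ∑ i, if (d i).1 = a then δ * ((d i).2 - 1) + (δ : ℝ) ^ 2 / 2 else 0
  calc ENNReal.ofReal (Real.exp (-s)) * f d
      ≤ (ENNReal.ofReal (Real.exp (-y)) + ENNReal.ofReal (Real.exp (-s) * Real.exp (-(t * s))) *
          ENNReal.ofReal (Real.exp (t * y))) * f d := by
        gcongr
        rw [← ENNReal.ofReal_mul (by positivity), ← ENNReal.ofReal_add (by positivity)
          (by positivity)]
        exact ENNReal.ofReal_le_ofReal (exp_neg_le_exp_neg_add ht y)
    _ ≤ _ := by
        rw [add_mul]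
        refine add_le_add le_rfl ?_
        exact mul_le_of_le_one_right zero_le (hf1 d)

end

end OfflineMAB

/-! ### Averaging over the set of suboptimal arms -/

namespace Finset

/-- Double counting of the pairs of a set with `k + 1` elements and one of its elements: the
set arises from a set with `k` elements by adding the distinguished element. -/
theorem sum_powersetCard_succ_sum {α M : Type*} [Fintype α] [DecidableEq α] [AddCommMonoid M]
    (k : ℕ) (h : Finset α → α → M) :
    ∑ S ∈ powersetCard (k + 1) univ, ∑ a ∈ S, h S a =
      ∑ T ∈ powersetCard k univ, ∑ a ∈ Tᶜ, h (insert a T) a := by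
  rw [sum_sigma', sum_sigma']
  refine sum_bij' (fun x _ => ⟨x.1.erase x.2, x.2⟩) (fun x _ => ⟨insert x.2 x.1, x.2⟩)
    ?_ ?_ ?_ ?_ ?_
  · rintro ⟨S, a⟩ hx
    simp only [mem_sigma, mem_powersetCard_univ, mem_compl] at hx ⊢
    exact ⟨by rw [card_erase_of_mem hx.2, hx.1, Nat.add_sub_cancel], notMem_erase a S⟩
  · rintro ⟨T, a⟩ hx
    simp only [mem_sigma, mem_powersetCard_univ, mem_compl] at hx ⊢
    exact ⟨by rw [card_insert_of_notMem hx.2, hx.1], mem_insert_self a T⟩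
  · rintro ⟨S, a⟩ hx
    simp only [mem_sigma] at hx
    simp [insert_erase hx.2]
  · rintro ⟨T, a⟩ hx
    simp only [mem_sigma, mem_compl] at hx
    simp [erase_insert hx.2]
  · rintro ⟨S, a⟩ hx
    simp only [mem_sigma] at hx
    simp [insert_erase hx.2]

end Finset

namespace OfflineMAB

/-- Averaging over the suboptimal sets. Here `g S b` stands for the expected probability that
the algorithm gives to arm `b` when `S` is the set of suboptimal arms. If adding an arm to `S`
cannot decrease `g` by much more than the factor `c`, then for some `S` of cardinality `K` the
algorithm puts the mass `c / 4 * (K / A)` on `S`. -/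
theorem exists_card_eq_le_sum {A K : ℕ} (hK : 0 < K) (hKA : K < A)
    (g : Finset (Fin A) → Fin A → ℝ) (hg0 : ∀ S b, 0 ≤ g S b) (hg : ∀ S, ∑ b, g S b = 1)
    {c η : ℝ} (hc : 0 < c) (hη0 : 0 ≤ η) (hη : ((A : ℝ) + 1) * η ≤ 1 / 2)
    (h : ∀ S, ∀ a ∉ S, ∀ U : Finset (Fin A),
      c * (∑ b ∈ U, g S b - η) ≤ ∑ b ∈ U, g (insert a S) b) :
    ∃ S : Finset (Fin A), S.card = K ∧ c / 4 * ((K : ℝ) / A) ≤ ∑ b ∈ S, g S b := by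
  obtain ⟨k, rfl⟩ : ∃ k, K = k + 1 := ⟨K - 1, by omega⟩
  by_contra! hlt
  have hA : (0 : ℝ) < A := by exact_mod_cast (by omega : 0 < A)
  have hkA : ((k + 1 : ℕ) : ℝ) / A ≤ 1 := by
    rw [div_le_one hA]
    exact_mod_cast hKA.le
  have hcard : ((Finset.powersetCard (k + 1) (Finset.univ : Finset (Fin A))).card : ℝ) *
      (k + 1 : ℕ) = (Finset.powersetCard k (Finset.univ : Finset (Fin A))).card * (A - k : ℝ) := by
    have := Finset.sum_powersetCard_succ_sum (α := Fin A) k (fun _ _ => (1 : ℝ))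
    simp only [Finset.sum_const, nsmul_eq_mul, mul_one] at this
    rw [← nsmul_eq_mul, ← nsmul_eq_mul, ← Finset.sum_const, ← Finset.sum_const]
    refine Eq.trans (Finset.sum_congr rfl fun S hS => ?_)
      (this.trans (Finset.sum_congr rfl fun T hT => ?_))
    · rw [Finset.mem_powersetCard_univ.mp hS]
    · rw [Finset.card_compl, Finset.mem_powersetCard_univ.mp hT, Fintype.card_fin,
        Nat.cast_sub (by omega)]
  have hpos : (0 : ℝ) < (Finset.powersetCard k (Finset.univ : Finset (Fin A))).card := by
    rw [Finset.card_powersetCard, Finset.card_univ, Fintype.card_fin]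
    exact_mod_cast Nat.choose_pos (by omega)
  have hup : ∑ S ∈ Finset.powersetCard (k + 1) (Finset.univ : Finset (Fin A)),
      ∑ a ∈ S, g S a < (Finset.powersetCard (k + 1) (Finset.univ : Finset (Fin A))).card *
        (c / 4 * (((k + 1 : ℕ) : ℝ) / A)) := by
    rw [← nsmul_eq_mul, ← Finset.sum_const]
    refine Finset.sum_lt_sum_of_nonempty ?_
      fun S hS => hlt S (Finset.mem_powersetCard_univ.mp hS)
    rw [Finset.powersetCard_nonempty, Finset.card_univ, Fintype.card_fin]
    exact hKA.le
  have hlow : (Finset.powersetCard k (Finset.univ : Finset (Fin A))).card * (c / 4) ≤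
      ∑ T ∈ Finset.powersetCard k (Finset.univ : Finset (Fin A)),
        ∑ a ∈ Tᶜ, g (insert a T) a := by
    rw [← nsmul_eq_mul]
    refine Finset.card_nsmul_le_sum _ _ _ fun T hT => ?_
    have hT' := Finset.mem_powersetCard_univ.mp hT
    obtain ⟨a, ha⟩ : ∃ a, a ∉ T := by
      by_contra! hall
      rw [Finset.eq_univ_iff_forall.mpr hall, Finset.card_univ, Fintype.card_fin] at hT'
      omega
    -- Otherwise the mass on `T` alone would make `insert a T` a witness.
    have hy : c * (∑ b ∈ T, g T b - η) ≤ c * (1 / 4) := by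
      have h1 := hlt (insert a T) (by rw [Finset.card_insert_of_notMem ha, hT'])
      have h2 := Finset.sum_le_sum_of_subset_of_nonneg (Finset.subset_insert a T)
        fun b _ _ => hg0 (insert a T) b
      have h3 := h T a ha T
      nlinarith
    have hy' := le_of_mul_le_mul_left hy hc
    have hsum : ∑ b ∈ Tᶜ, g T b = 1 - ∑ b ∈ T, g T b := by
      rw [← hg T, ← Finset.sum_add_sum_compl T]
      ring
    have hle : ((Tᶜ.card : ℕ) : ℝ) ≤ A := by
      exact_mod_cast (Finset.card_le_univ _).trans_eq (Fintype.card_fin A)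
    have hcη : (Tᶜ.card : ℝ) * η ≤ A * η := mul_le_mul_of_nonneg_right hle hη0
    calc c / 4 ≤ c * (∑ b ∈ Tᶜ, g T b - Tᶜ.card * η) := by
          rw [div_eq_mul_inv]
          refine mul_le_mul_of_nonneg_left ?_ hc.le
          rw [hsum]
          linarith
      _ = ∑ b ∈ Tᶜ, c * (g T b - η) := by
          rw [← Finset.mul_sum, Finset.sum_sub_distrib, Finset.sum_const, nsmul_eq_mul]
      _ ≤ ∑ b ∈ Tᶜ, g (insert b T) b := by
          refine Finset.sum_le_sum fun b hb => ?_
          simpa using h T b (Finset.mem_compl.mp hb) {b}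
  rw [Finset.sum_powersetCard_succ_sum] at hup
  have hfin : ((Finset.powersetCard (k + 1) (Finset.univ : Finset (Fin A))).card : ℝ) *
      (c / 4 * (((k + 1 : ℕ) : ℝ) / A)) ≤
      (Finset.powersetCard k (Finset.univ : Finset (Fin A))).card * (c / 4) := by
    have h1 : (A - k : ℝ) / A ≤ 1 := by
      rw [div_le_one hA]
      linarith [(Nat.cast_nonneg k : (0 : ℝ) ≤ k)]
    calc _ = ((Finset.powersetCard (k + 1) (Finset.univ : Finset (Fin A))).card : ℝ) *
            (k + 1 : ℕ) / A * (c / 4) := by ring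
      _ = (Finset.powersetCard k (Finset.univ : Finset (Fin A))).card * (c / 4) *
            ((A - k : ℝ) / A) := by rw [hcard]; ring
      _ ≤ _ := mul_le_of_le_one_right (by positivity) h1
  linarith

/-! ### Expected arm probabilities of an algorithm -/

section

variable {A n : ℕ}

/-- The probability that the algorithm gives to arm `b` on a dataset, averaged over its
internal randomness. -/
noncomputable def armProb (alg : Kernel (Dataset A n) (Policy A)) (b : Fin A)
    (d : Dataset A n) : ℝ≥0∞ :=
  ∫⁻ p, ENNReal.ofReal (p.1 b) ∂alg d

theorem measurable_coord (b : Fin A) : Measurable fun p : Policy A => p.1 b :=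
  (measurable_pi_apply b).comp measurable_subtype_coe

theorem measurable_armProb (alg : Kernel (Dataset A n) (Policy A)) (b : Fin A) :
    Measurable (armProb alg b) :=
  (measurable_coord b).ennreal_ofReal.lintegral_kernel

theorem sum_armProb (alg : Kernel (Dataset A n) (Policy A)) [IsMarkovKernel alg]
    (d : Dataset A n) : ∑ b, armProb alg b d = 1 := by
  simp only [armProb]
  rw [← lintegral_finsetSum _ fun b _ => (measurable_coord b).ennreal_ofReal]
  have h : ∀ p : Policy A, ∑ b, ENNReal.ofReal (p.1 b) = 1 := fun p => by
    rw [← ENNReal.ofReal_sum_of_nonneg fun b _ => p.2.1 b, p.2.2, ENNReal.ofReal_one]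
  simp [h]

theorem sum_armProb_le_one (alg : Kernel (Dataset A n) (Policy A)) [IsMarkovKernel alg]
    (U : Finset (Fin A)) (d : Dataset A n) : ∑ b ∈ U, armProb alg b d ≤ 1 :=
  (sum_armProb alg d).le.trans' (Finset.sum_le_univ_sum_of_nonneg fun _ => zero_le)

/-- The expected probability that the algorithm gives to arm `b` on the bandit `M`. -/
noncomputable def expectedArmProb (M : Bandit A) (alg : Kernel (Dataset A n) (Policy A))
    (b : Fin A) : ℝ :=
  (∫⁻ d, armProb alg b d ∂M.dataLaw n).toReal

theorem expectedArmProb_nonneg (M : Bandit A) (alg : Kernel (Dataset A n) (Policy A))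
    (b : Fin A) : 0 ≤ expectedArmProb M alg b :=
  ENNReal.toReal_nonneg

theorem ofReal_sum_expectedArmProb (M : Bandit A) (alg : Kernel (Dataset A n) (Policy A))
    [IsMarkovKernel alg] (U : Finset (Fin A)) :
    ENNReal.ofReal (∑ b ∈ U, expectedArmProb M alg b) =
      ∫⁻ d, ∑ b ∈ U, armProb alg b d ∂M.dataLaw n := by
  have h : ∀ b, ∫⁻ d, armProb alg b d ∂M.dataLaw n ≠ ∞ := fun b => by
    have h1 : ∫⁻ d, armProb alg b d ∂M.dataLaw n ≤ ∫⁻ _, 1 ∂M.dataLaw n :=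
      lintegral_mono fun d => by simpa using sum_armProb_le_one alg {b} d
    exact ne_top_of_le_ne_top (by simp) h1
  rw [lintegral_finsetSum _ fun b _ => measurable_armProb alg b,
    ENNReal.ofReal_sum_of_nonneg fun b _ => expectedArmProb_nonneg _ _ b]
  exact Finset.sum_congr rfl fun b _ => ENNReal.ofReal_toReal (h b)

theorem sum_expectedArmProb (M : Bandit A) (alg : Kernel (Dataset A n) (Policy A))
    [IsMarkovKernel alg] : ∑ b, expectedArmProb M alg b = 1 := by
  have h := ofReal_sum_expectedArmProb M alg Finset.univ
  simp only [sum_armProb, lintegral_const, measure_univ, mul_one] at h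
  exact ENNReal.ofReal_eq_one.mp h

theorem expectedSubOpt_gapBandit [NeZero A] (δ : Set.Icc (0 : ℝ) 1) (S : Finset (Fin A))
    (hS : S ≠ Finset.univ) (alg : Kernel (Dataset A n) (Policy A)) [IsMarkovKernel alg] :
    (gapBandit δ S).expectedSubOpt alg =
      δ * ∑ b ∈ S, expectedArmProb (gapBandit δ S) alg b := by
  have hm : Measurable fun p : Policy A => ∑ b ∈ S, p.1 b :=
    Finset.measurable_sum _ fun b _ => measurable_coord b
  simp only [Bandit.expectedSubOpt, subOpt_gapBandit δ S hS]
  rw [integral_const_mul, integral_eq_lintegral_of_nonneg_ae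
    (ae_of_all _ fun p => Finset.sum_nonneg fun b _ => p.2.1 b) hm.aestronglyMeasurable,
    Measure.lintegral_bind alg.measurable.aemeasurable hm.ennreal_ofReal.aemeasurable]
  have h : ∀ d, ∫⁻ p, ENNReal.ofReal (∑ b ∈ S, p.1 b) ∂alg d = ∑ b ∈ S, armProb alg b d := by
    intro d
    simp only [armProb]
    rw [← lintegral_finsetSum _ fun b _ => (measurable_coord b).ennreal_ofReal]
    exact lintegral_congr fun p => ENNReal.ofReal_sum_of_nonneg fun b _ => p.2.1 b
  simp only [h]
  rw [← ofReal_sum_expectedArmProb,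
    ENNReal.toReal_ofReal (Finset.sum_nonneg fun b _ => expectedArmProb_nonneg _ _ b)]

/-- The change of measure, in terms of the expected mass that the algorithm puts on a set `U` of
arms. -/
theorem sum_expectedArmProb_insert_ge [NeZero A] (δ : Set.Icc (0 : ℝ) 1)
    (alg : Kernel (Dataset A n) (Policy A)) [IsMarkovKernel alg] (S : Finset (Fin A))
    {a : Fin A} (ha : a ∉ S) (U : Finset (Fin A)) {s t : ℝ} (ht : 0 ≤ t) :
    Real.exp (-s) * (∑ b ∈ U, expectedArmProb (gapBandit δ S) alg b -
        Real.exp (-(t * s)) * (1 + (Real.exp ((t ^ 2 + t) * δ ^ 2 / 2) - 1) / A) ^ n) ≤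
      ∑ b ∈ U, expectedArmProb (gapBandit δ (insert a S)) alg b := by
  have h := lintegral_le_lintegral_insert δ S ha (s := s) ht
    (Finset.measurable_sum U fun b _ => measurable_armProb alg b) (sum_armProb_le_one alg U)
  have h0 : 0 ≤ 1 + (Real.exp ((t ^ 2 + t) * δ ^ 2 / 2) - 1) / A := by
    have : 1 ≤ Real.exp ((t ^ 2 + t) * δ ^ 2 / 2) := Real.one_le_exp (by positivity)
    have : 0 ≤ (Real.exp ((t ^ 2 + t) * δ ^ 2 / 2) - 1) / A :=
      div_nonneg (by linarith) (Nat.cast_nonneg A)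
    linarith
  have hs : ∀ M : Bandit A, 0 ≤ ∑ b ∈ U, expectedArmProb M alg b := fun M =>
    Finset.sum_nonneg fun b _ => expectedArmProb_nonneg _ _ b
  rw [← ofReal_sum_expectedArmProb, ← ofReal_sum_expectedArmProb, ← ENNReal.ofReal_pow h0,
    ← ENNReal.ofReal_mul (by positivity), ← ENNReal.ofReal_mul (by positivity),
    ← ENNReal.ofReal_add (hs _) (by positivity),
    ENNReal.ofReal_le_ofReal_iff (add_nonneg (hs _) (by positivity))] at h
  linarith

end

/-! ### The choice of the gap -/

/-- For the gap `δ = √(A / (n * log A))`, the error term of the change of measure with moment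
order `t = log A` and threshold `s = 6` remains small when it is summed over the arms. -/
theorem error_term_le {A n : ℕ} (hA : 2 ≤ A) (hn : 6 * A ^ 2 ≤ n) {δ : ℝ}
    (hδ : δ ^ 2 = A / (n * Real.log A)) :
    ((A : ℝ) + 1) * (Real.exp (-(Real.log A * 6)) *
      (1 + (Real.exp ((Real.log A ^ 2 + Real.log A) * δ ^ 2 / 2) - 1) / A) ^ n) ≤ 1 / 2 := by
  have hA' : (2 : ℝ) ≤ A := by exact_mod_cast hA
  have hn' : (6 : ℝ) * A ^ 2 ≤ n := by exact_mod_cast hn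
  have hn0 : (0 : ℝ) < n := lt_of_lt_of_le (by positivity) hn'
  have hlog : 0 < Real.log A := Real.log_pos (by linarith)
  have hlogA : Real.log A ≤ A - 1 := Real.log_le_sub_one_of_pos (by linarith)
  have hu : (Real.log A ^ 2 + Real.log A) * δ ^ 2 / 2 = (Real.log A + 1) * A / (2 * n) := by
    rw [hδ]
    field_simp
  rw [hu]
  set t := Real.log A with ht
  have hu0 : 0 ≤ (t + 1) * A / (2 * n) := by positivity
  have hu1 : (t + 1) * A / (2 * n) ≤ 1 := by
    rw [div_le_one (by positivity)]
    nlinarith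
  -- The condition on `n` makes this exponent at most `1`, where `exp u - 1 ≤ 2 * u`.
  have hexp : Real.exp ((t + 1) * A / (2 * n)) - 1 ≤ 2 * ((t + 1) * A / (2 * n)) := by
    have := Real.abs_exp_sub_one_le (x := (t + 1) * A / (2 * n)) (by rwa [abs_of_nonneg hu0])
    rw [abs_of_nonneg hu0] at this
    exact (le_abs_self _).trans this
  have hone : 1 ≤ Real.exp ((t + 1) * A / (2 * n)) := Real.one_le_exp hu0
  have hpow : (1 + (Real.exp ((t + 1) * A / (2 * n)) - 1) / A) ^ n ≤ Real.exp (t + 1) := by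
    have hx : (Real.exp ((t + 1) * A / (2 * n)) - 1) / A ≤ (t + 1) / n := by
      rw [div_le_iff₀ (by linarith)]
      refine hexp.trans_eq ?_
      field_simp
    have hx0 : 0 ≤ (Real.exp ((t + 1) * A / (2 * n)) - 1) / A :=
      div_nonneg (by linarith) (by linarith)
    calc (1 + (Real.exp ((t + 1) * A / (2 * n)) - 1) / A) ^ n
        ≤ Real.exp ((t + 1) / n) ^ n := by
          refine pow_le_pow_left₀ (by linarith) ?_ n
          linarith [Real.add_one_le_exp ((t + 1) / n)]
      _ = Real.exp (t + 1) := by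
          rw [← Real.exp_nat_mul]
          congr 1
          field_simp
  calc ((A : ℝ) + 1) * (Real.exp (-(t * 6)) *
        (1 + (Real.exp ((t + 1) * A / (2 * n)) - 1) / A) ^ n)
      ≤ (2 * A) * (Real.exp (-(t * 6)) * Real.exp (t + 1)) := by
        gcongr
        linarith
    _ = 2 * Real.exp 1 / A ^ 4 := by
        have hAt : (A : ℝ) = Real.exp t := (Real.exp_log (by linarith)).symm
        rw [hAt, ← Real.exp_nat_mul, eq_div_iff (Real.exp_ne_zero _), mul_assoc, mul_assoc,
          ← Real.exp_add, ← Real.exp_add, ← Real.exp_add]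
        congr 2
        push_cast
        ring
    _ ≤ 1 / 2 := by
        rw [div_le_iff₀ (by positivity)]
        have h4 : (2 : ℝ) ^ 4 ≤ (A : ℝ) ^ 4 := pow_le_pow_left₀ (by norm_num) hA' 4
        linarith [Real.exp_one_lt_d9]

end OfflineMAB

theorem mainTheorem4 :
    ∃ c : ℝ, 0 < c ∧
      ∀ A K : ℕ, 0 < K → K < A →
        ∃ N : ℕ, ∀ n : ℕ, N ≤ n →
          ∀ alg : ProbabilityTheory.Kernel (OfflineMAB.Dataset A n) (OfflineMAB.Policy A),
            ProbabilityTheory.IsMarkovKernel alg →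
              ∃ M : OfflineMAB.Bandit A,
                M.HasUniformBehavior ∧
                M.suboptimalArms.card = K ∧
                c * ((K : ℝ) / Real.sqrt ((n : ℝ) * (A : ℝ) * Real.log (A : ℝ))) ≤
                  M.expectedSubOpt alg := by
  refine ⟨Real.exp (-6) / 4, by positivity, fun A K hK hKA =>
    ⟨6 * A ^ 2, fun n hn alg halg => ?_⟩⟩
  have hA : 2 ≤ A := by omega
  have : NeZero A := ⟨by omega⟩
  have hA' : (2 : ℝ) ≤ A := by exact_mod_cast hA
  have hn' : (6 : ℝ) * A ^ 2 ≤ n := by exact_mod_cast hn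
  have hn0 : (0 : ℝ) < n := lt_of_lt_of_le (by positivity) hn'
  have hlog : 0 < Real.log A := Real.log_pos (by linarith)
  have hlog2 : 1 / 2 ≤ Real.log A :=
    (Real.log_two_gt_d9.le.trans' (by norm_num)).trans (Real.log_le_log (by norm_num) hA')
  have hprod : 0 < (n : ℝ) * A * Real.log A := by positivity
  have hδ0 : 0 < (A : ℝ) / Real.sqrt (n * A * Real.log A) :=
    div_pos (by linarith) (Real.sqrt_pos.mpr hprod)
  have hδ1 : (A : ℝ) / Real.sqrt (n * A * Real.log A) ≤ 1 := by
    rw [div_le_one (Real.sqrt_pos.mpr hprod)]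
    refine Real.le_sqrt_of_sq_le ?_
    have h1 : (A : ℝ) ≤ n * Real.log A := by nlinarith
    nlinarith
  have hδsq : ((A : ℝ) / Real.sqrt (n * A * Real.log A)) ^ 2 = A / (n * Real.log A) := by
    rw [div_pow, Real.sq_sqrt hprod.le]
    field_simp
  -- This is `√(A / (n * log A))`, in the form in which the target bound is `δ * (K / A)`.
  set δ : Set.Icc (0 : ℝ) 1 := ⟨A / Real.sqrt (n * A * Real.log A), hδ0.le, hδ1⟩ with hδ
  have hη0 : 0 ≤ Real.exp (-(Real.log A * 6)) *
      (1 + (Real.exp ((Real.log A ^ 2 + Real.log A) * (δ : ℝ) ^ 2 / 2) - 1) / A) ^ n := by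
    have : 1 ≤ Real.exp ((Real.log A ^ 2 + Real.log A) * (δ : ℝ) ^ 2 / 2) :=
      Real.one_le_exp (by positivity)
    have : 0 ≤ (Real.exp ((Real.log A ^ 2 + Real.log A) * (δ : ℝ) ^ 2 / 2) - 1) / A :=
      div_nonneg (by linarith) (by linarith)
    positivity
  obtain ⟨S, hSK, hS⟩ := OfflineMAB.exists_card_eq_le_sum hK hKA
    (fun S b => OfflineMAB.expectedArmProb (OfflineMAB.gapBandit δ S) alg b)
    (fun _ _ => OfflineMAB.expectedArmProb_nonneg _ _ _)
    (fun _ => OfflineMAB.sum_expectedArmProb _ alg)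
    (Real.exp_pos (-6)) hη0 (OfflineMAB.error_term_le hA hn hδsq)
    (fun S a ha U => OfflineMAB.sum_expectedArmProb_insert_ge δ alg S ha U hlog.le)
  have hSu : S ≠ Finset.univ := by
    rintro rfl
    rw [Finset.card_univ, Fintype.card_fin] at hSK
    omega
  refine ⟨OfflineMAB.gapBandit δ S, fun _ => rfl, ?_, ?_⟩
  · rw [OfflineMAB.Bandit.suboptimalArms, OfflineMAB.optimalArms_gapBandit δ S hδ0 hSu,
      compl_compl, hSK]
  · rw [OfflineMAB.expectedSubOpt_gapBandit δ S hSu alg]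
    refine le_trans (le_of_eq ?_) (mul_le_mul_of_nonneg_left hS hδ0.le)
    simp only [hδ]
    field_simp
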